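/- Consider $N$ agents and a principal who selects $k$ of them, where $1\le k\le N$. Agent $i$ has a value $v_i\in[0,1]$ drawn independently from a prior $\mathcal F_i$, an arbitrary Borel probability measure on $[0,1]$ (priors may differ between agents), and gets utility $u_i(v_i)$ if she is selected, where $u_i\colon[0,1]\to\mathbb R_{\ge0}$ is continuous and weakly increasing with $u_i(v)>0$ for every $v>0$. Write $\mathcal I=(\mathcal F_1,\dots,\mathcal F_N;u_1,\dots,u_N)$. A strategy of agent $i$ is a signaling scheme $\mathcal Z_i=(\Sigma_i,\pi_i)$: a measurable space $\Sigma_i$ and a probability kernel $\pi_i$ from $[0,1]$ to $\Sigma_i$. She commits to it before observing $v_i$, and then sends $\sigma_i\sim\pi_i(\cdot\mid v_i)$; the pairs $(v_i,\sigma_i)$ are independent over $i$. Let $e_i(\sigma_i)=\mathbb E[v_i\mid\sigma_i]$ be the posterior mean and $e_{(1)}\ge\dots\ge e_{(N)}$ the sorted posterior means. The principal selects $k$ agents with the highest posterior means, breaking ties uniformly at random: agent $i$ is selected with probability $\rho_i(\sigma)=1$ if $e_i>e_{(k)}$, $\rho_i(\sigma)=(k-|\{j:e_j>e_{(k)}\}|)/|\{j:e_j=e_{(k)}\}|$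 if $e_i=e_{(k)}$, and $\rho_i(\sigma)=0$ otherwise. Under a strategy profile $\mathcal Z=(\mathcal Z_1,\dots,\mathcal Z_N)$ the expected utility of agent $i$ and the social welfare are $$u_i(\mathcal Z)=\mathbb E\big[\rho_i(\sigma)\,\mathbb E[u_i(v_i)\mid\sigma_i]\big],\qquad \mathrm{SW}(\mathcal Z)=\mathbb E\Big[\sum_{j=1}^k e_{(j)}(\sigma)\Big].$$ The profile $\mathcal Z$ is a Nash equilibrium if no agent can increase her expected utility by unilaterally replacing $\mathcal Z_i$ with another signaling scheme. The first-best welfare is $$\mathrm{SW}^{\max}(\mathcal I)=\mathbb E_{v\sim\bigotimes_i\mathcal F_i}\Big[\max_{S\subseteq[N],\,|S|=k}\ \sum_{i\in S}v_i\Big],$$ and, if at least one Nash equilibrium exists, the price of anarchy is $$\mathrm{PoA}(\mathcal I)=\frac{\mathrm{SW}^{\max}(\mathcal I)}{\inf\{\mathrm{SW}(\mathcal Z):\mathcal Z\text{ is a Nash equilibrium on }\mathcal I\}}\in[0,\infty],$$ with $0/0=0$ and $x/0=\infty$ for $x>0$. **Theorem.** For all $1\le k\le N$ and every instance $\mathcal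 I$ as above that has a Nash equilibrium, $\mathrm{PoA}(\mathcal I)\le 11+5\sqrt5\approx22.18$. -/

import Mathlib

open MeasureTheory ProbabilityTheory
open scoped ENNReal NNReal

universe u

namespace CompetitivePersuasion

noncomputable section

/-- The data of a competitive Bayesian persuasion game with `N` agents: independent priors on
`[0, 1]`, and for every agent the utility that she receives when selected with a given value. -/
structure GameInstance (N : ℕ) where
  /-- The prior distribution of the value of each agent. -/
  prior : Fin N → ProbabilityMeasure unitInterval
  /-- The utility of each agent from being selected, as a function of her value. -/
  utility : Fin N → unitInterval → ℝ≥0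
  continuous_utility : ∀ i, Continuous (utility i)
  monotone_utility : ∀ i, Monotone (utility i)
  utility_pos : ∀ i v, 0 < v → 0 < utility i v

/-- A signaling scheme: a measurable space of signals, and a probability kernel from values
to signals. -/
structure SignalingScheme where
  /-- The space of signals. -/
  Signal : Type u
  /-- The measurable sets of signals. -/
  measurableSpace : MeasurableSpace Signal
  /-- The law of the signal given the value. -/
  kernel : Kernel unitInterval Signal
  isMarkov : IsMarkovKernel kernel

attribute [instance] SignalingScheme.measurableSpace SignalingScheme.isMarkov

/-- The value of an agent as an extended nonnegative real. -/
def value (v : unitInterval) : ℝ≥0∞ := ENNReal.ofReal (v : ℝ)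

namespace SignalingScheme

/-- The law of the signal when the value has law `F`. -/
def signalLaw (Z : SignalingScheme.{u}) (F : ProbabilityMeasure unitInterval) : Measure Z.Signal :=
  Z.kernel ∘ₘ (F : Measure unitInterval)

/-- The conditional expectation `𝔼[f(v) ∣ s]`, under the posterior that Bayes' rule assigns to
the value `v` (of prior law `F`) after the signal `s`. -/
def posteriorExpectation (Z : SignalingScheme.{u}) (F : ProbabilityMeasure unitInterval)
    (f : unitInterval → ℝ≥0∞) (s : Z.Signal) : ℝ≥0∞ :=
  ∫⁻ v, f v ∂(posterior Z.kernel (F : Measure unitInterval) s)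

/-- The posterior mean of the value after the signal `s`. -/
def posteriorMean (Z : SignalingScheme.{u}) (F : ProbabilityMeasure unitInterval)
    (s : Z.Signal) : ℝ≥0∞ :=
  Z.posteriorExpectation F value s

end SignalingScheme

/-- The entries of `e` in decreasing order (with repetitions). -/
def sortedDesc {N : ℕ} (e : Fin N → ℝ≥0∞) : Fin N → ℝ≥0∞ :=
  e ∘ Tuple.sort (fun i => OrderDual.toDual (e i))

/-- The sum of the `k` largest entries of `e`. -/
def topSum {N : ℕ} (k : ℕ) (e : Fin N → ℝ≥0∞) : ℝ≥0∞ :=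
  ∑ j ∈ Finset.univ.filter (fun j : Fin N => (j : ℕ) < k), sortedDesc e j

/-- The `k`-th largest entry of `e`, for `1 ≤ k ≤ N`. -/
def kthLargest {N : ℕ} (k : ℕ) (e : Fin N → ℝ≥0∞) : ℝ≥0∞ :=
  if h : k - 1 < N then sortedDesc e ⟨k - 1, h⟩ else 0

/-- The agents that are selected without a tie. -/
def winners {N : ℕ} (k : ℕ) (e : Fin N → ℝ≥0∞) : Finset (Fin N) :=
  {i | kthLargest k e < e i}

/-- The agents that tie for the remaining places. -/
def tied {N : ℕ} (k : ℕ) (e : Fin N → ℝ≥0∞) : Finset (Fin N) :=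
  {i | e i = kthLargest k e}

/-- The probability that agent `i` is among the `k` selected agents, given the posterior means
`e`, when ties are broken uniformly at random. -/
def selectionProb {N : ℕ} (k : ℕ) (e : Fin N → ℝ≥0∞) (i : Fin N) : ℝ≥0∞ :=
  if i ∈ winners k e then 1
  else if i ∈ tied k e then ((k : ℝ≥0∞) - (winners k e).card) / (tied k e).card
  else 0

/-- A strategy profile: one signaling scheme for every agent. -/
abbrev Profile (N : ℕ) := Fin N → SignalingScheme.{u}

namespace GameInstance

variable {N : ℕ} (G : GameInstance N)

/-- The first-best welfare: the expected sum of the `k` best values under full information. -/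
def firstBest (k : ℕ) : ℝ≥0∞ :=
  ∫⁻ v : Fin N → unitInterval,
    (Finset.powersetCard k Finset.univ).sup (fun S => ∑ i ∈ S, value (v i))
    ∂(Measure.pi fun i => (G.prior i : Measure unitInterval))

/-- The joint law of the independent signals of all agents. -/
def jointLaw (Z : Profile.{u} N) : Measure (∀ i, (Z i).Signal) :=
  Measure.pi fun i => (Z i).signalLaw (G.prior i)

/-- The posterior means of all agents after the signal profile `s`. -/
def means (Z : Profile.{u} N) (s : ∀ i, (Z i).Signal) (i : Fin N) : ℝ≥0∞ :=
  (Z i).posteriorMean (G.prior i) (s i)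

/-- The expected utility of agent `i` under the strategy profile `Z`. -/
def expectedUtility (k : ℕ) (Z : Profile.{u} N) (i : Fin N) : ℝ≥0∞ :=
  ∫⁻ s, selectionProb k (G.means Z s) i *
    (Z i).posteriorExpectation (G.prior i) (fun v => (G.utility i v : ℝ≥0∞)) (s i) ∂(G.jointLaw Z)

/-- The expected social welfare under the strategy profile `Z`: the expected sum of the `k`
highest posterior means. -/
def socialWelfare (k : ℕ) (Z : Profile.{u} N) : ℝ≥0∞ :=
  ∫⁻ s, topSum k (G.means Z s) ∂(G.jointLaw Z)

/-- The Nash equilibria: no agent gains by a unilateral change of her signaling scheme. -/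
def nashEquilibria (k : ℕ) : Set (Profile.{u} N) :=
  {Z | ∀ (i : Fin N) (Z' : SignalingScheme.{u}),
    G.expectedUtility k (Function.update Z i Z') i ≤ G.expectedUtility k Z i}

/-- The price of anarchy: the first-best welfare over the infimum of the equilibrium welfare.
Division is that of `ℝ≥0∞`, so a positive first-best welfare over `0` is `∞`, and `0 / 0 = 0`. -/
def priceOfAnarchy (k : ℕ) : ℝ≥0∞ :=
  G.firstBest k / ⨅ Z ∈ nashEquilibria.{u} G k, G.socialWelfare k Z

end GameInstance

end

end CompetitivePersuasion

/-! The proof gives the stronger factor 8. Fix an equilibrium with welfare `W` and a threshold `t >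
0` with `k * t ≥ 2 * W`. The k-th largest posterior mean has expectation at most `W / k ≤ t / 2`, so
by Markov's inequality it reaches `t` with probability at most 1/2. Hence any agent who induces a
posterior mean of at least `t` is selected with probability at least 1/2
(`half_le_interimSelection`).

At a signal with expected excess `g = 𝔼[(v - t)⁺ ∣ s]`, an agent can pool all values above `t` with
a fraction `a = min 1 (g / t)` of the lower ones. The excess pays for the deficit of the lower
values, so the pooled mean is at least `t`, and every value is selected with probability at least `a
/ 2`. This bound is uniform in the value, so the shape of the utility does not matter. In
equilibrium the selection probability `H` at the signal is therefore at least `a / 2`. With `e` the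
posterior mean, this gives `g ≤ 2 * t * H` if `g ≤ t`, and `g ≤ e ≤ 2 * H * e` otherwise
(`ae_excess_le_of_isBestResponse`).

Selection probabilities sum to `k` and selected means to at most `W`, so the total expected excess
is at most `2 * k * t + 2 * W`. The first best is at most `k * t` plus the total excess, hence at
most `3 * k * t + 2 * W`, which is `8 * W` for `k * t = 2 * W`. If `W = 0`, let `t` tend to 0. -/

namespace CompetitivePersuasion

/-! ### Order statistics and the selection rule -/

section Selection

variable {N : ℕ} {k : ℕ}

lemma antitone_sortedDesc (e : Fin N → ℝ≥0∞) : Antitone (sortedDesc e) := by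
  intro a b hab
  exact OrderDual.toDual_le_toDual.mp (Tuple.monotone_sort (fun i => OrderDual.toDual (e i)) hab)

lemma card_filter_sortedDesc (e : Fin N → ℝ≥0∞) (p : ℝ≥0∞ → Prop) [DecidablePred p] :
    (Finset.univ.filter fun j => p (sortedDesc e j)).card =
      (Finset.univ.filter fun j => p (e j)).card := by
  refine Finset.card_bij (fun j _ => Tuple.sort (fun i => OrderDual.toDual (e i)) j) ?_ ?_ ?_
  · intro j hj
    simp only [Finset.mem_filter, Finset.mem_univ, true_and] at hj ⊢
    exact hj
  · intro a _ b _ h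
    simpa using h
  · intro b hb
    have h : p (e (Tuple.sort (fun i => OrderDual.toDual (e i))
        ((Tuple.sort (fun i => OrderDual.toDual (e i))).symm b))) := by
      rw [Equiv.apply_symm_apply]
      exact (Finset.mem_filter.1 hb).2
    exact ⟨(Tuple.sort (fun i => OrderDual.toDual (e i))).symm b,
      Finset.mem_filter.2 ⟨Finset.mem_univ _, h⟩, by simp⟩

/-- The positions where an upward closed property holds form an initial segment of the sorted list.
A general `p` serves both `c ≤ x` and `c < x`. -/
lemma prop_kthLargest_iff (hk : 1 ≤ k) (hkN : k ≤ N) (e : Fin N → ℝ≥0∞) (p : ℝ≥0∞ → Prop)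
    [DecidablePred p] (hp : ∀ a b, a ≤ b → p a → p b) :
    p (kthLargest k e) ↔ k ≤ (Finset.univ.filter fun j => p (e j)).card := by
  have hlt : k - 1 < N := by omega
  rw [kthLargest, dif_pos hlt, ← card_filter_sortedDesc]
  constructor
  · intro h
    have hsub : Finset.univ.filter (fun j : Fin N => (j : ℕ) < k) ⊆
        Finset.univ.filter fun j => p (sortedDesc e j) := by
      intro j hj
      simp only [Finset.mem_filter, Finset.mem_univ, true_and] at hj ⊢
      refine hp _ _ (antitone_sortedDesc e ?_) h
      rw [Fin.le_def]
      simp only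
      omega
    calc k = (Finset.univ.filter (fun j : Fin N => (j : ℕ) < k)).card := by
          rw [Fin.card_filter_val_lt, min_eq_right hkN]
      _ ≤ _ := Finset.card_le_card hsub
  · intro h
    by_contra hn
    have hsub : Finset.univ.filter (fun j => p (sortedDesc e j)) ⊆
        Finset.univ.filter (fun j : Fin N => (j : ℕ) < k - 1) := by
      intro j hj
      simp only [Finset.mem_filter, Finset.mem_univ, true_and] at hj ⊢
      by_contra hj'
      refine hn (hp _ _ (antitone_sortedDesc e ?_) hj)
      rw [Fin.le_def]
      simp only
      omega
    have := Finset.card_le_card hsub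
    rw [Fin.card_filter_val_lt] at this
    omega

lemma le_kthLargest_iff (hk : 1 ≤ k) (hkN : k ≤ N) (e : Fin N → ℝ≥0∞) (c : ℝ≥0∞) :
    c ≤ kthLargest k e ↔ k ≤ (Finset.univ.filter fun j => c ≤ e j).card :=
  prop_kthLargest_iff hk hkN e (fun x => c ≤ x) fun _ _ hab ha => ha.trans hab

lemma lt_kthLargest_iff (hk : 1 ≤ k) (hkN : k ≤ N) (e : Fin N → ℝ≥0∞) (c : ℝ≥0∞) :
    c < kthLargest k e ↔ k ≤ (Finset.univ.filter fun j => c < e j).card :=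
  prop_kthLargest_iff hk hkN e (fun x => c < x) fun _ _ hab ha => ha.trans_le hab

lemma card_winners_lt (hk : 1 ≤ k) (hkN : k ≤ N) (e : Fin N → ℝ≥0∞) :
    (winners k e).card < k := by
  by_contra h
  exact lt_irrefl _ ((lt_kthLargest_iff hk hkN e (kthLargest k e)).2 (not_lt.mp h))

lemma card_winners_add_card_tied (e : Fin N → ℝ≥0∞) :
    (winners k e).card + (tied k e).card =
      (Finset.univ.filter fun j => kthLargest k e ≤ e j).card := by
  rw [← Finset.card_union_of_disjoint]
  · congr 1
    ext j
    simp only [winners, tied, Finset.mem_union, Finset.mem_filter, Finset.mem_univ, true_and]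
    rw [le_iff_lt_or_eq, eq_comm (a := e j)]
  · rw [Finset.disjoint_left]
    intro j hj hj'
    simp only [winners, tied, Finset.mem_filter, Finset.mem_univ, true_and] at hj hj'
    exact hj.ne hj'.symm

lemma le_card_winners_add_card_tied (hk : 1 ≤ k) (hkN : k ≤ N) (e : Fin N → ℝ≥0∞) :
    k ≤ (winners k e).card + (tied k e).card := by
  rw [card_winners_add_card_tied]
  exact (le_kthLargest_iff hk hkN e _).1 le_rfl

lemma card_tied_pos (hk : 1 ≤ k) (hkN : k ≤ N) (e : Fin N → ℝ≥0∞) : 0 < (tied k e).card := by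
  have := card_winners_lt hk hkN e
  have := le_card_winners_add_card_tied hk hkN e
  omega

lemma selectionProb_le_one (hk : 1 ≤ k) (hkN : k ≤ N) (e : Fin N → ℝ≥0∞) (i : Fin N) :
    selectionProb k e i ≤ 1 := by
  unfold selectionProb
  split_ifs
  · exact le_rfl
  · refine ENNReal.div_le_of_le_mul ?_
    rw [one_mul, tsub_le_iff_left]
    exact_mod_cast le_card_winners_add_card_tied hk hkN e
  · exact zero_le

/-- The tied agents share exactly the places that the winners leave; the tied set is never empty, so
the division is harmless. -/
lemma sum_selectionProb (hk : 1 ≤ k) (hkN : k ≤ N) (e : Fin N → ℝ≥0∞) :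
    ∑ i, selectionProb k e i = k := by
  have hdis : ∀ i, selectionProb k e i = (if i ∈ winners k e then 1 else 0) +
      (if i ∈ tied k e then ((k : ℝ≥0∞) - (winners k e).card) / (tied k e).card else 0) := by
    intro i
    unfold selectionProb
    by_cases h1 : i ∈ winners k e
    · have h2 : i ∉ tied k e := by
        simp only [winners, tied, Finset.mem_filter, Finset.mem_univ, true_and] at h1 ⊢
        exact h1.ne'
      simp [h1, h2]
    · simp [h1]
  have hT : ((tied k e).card : ℝ≥0∞) ≠ 0 := by
    exact_mod_cast (card_tied_pos hk hkN e).ne'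
  simp_rw [hdis]
  rw [Finset.sum_add_distrib, Finset.sum_ite_mem, Finset.sum_ite_mem, Finset.univ_inter,
    Finset.univ_inter, Finset.sum_const, Finset.sum_const, nsmul_eq_mul, nsmul_eq_mul, mul_one,
    ENNReal.mul_div_cancel hT (ENNReal.natCast_ne_top _)]
  refine add_tsub_cancel_of_le ?_
  exact_mod_cast (card_winners_lt hk hkN e).le

lemma mul_kthLargest_le_topSum (hk : 1 ≤ k) (hkN : k ≤ N) (e : Fin N → ℝ≥0∞) :
    k * kthLargest k e ≤ topSum k e := by
  have hlt : k - 1 < N := by omega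
  have hcard : (Finset.univ.filter (fun j : Fin N => (j : ℕ) < k)).card = k := by
    rw [Fin.card_filter_val_lt, min_eq_right hkN]
  rw [kthLargest, dif_pos hlt, topSum, ← nsmul_eq_mul]
  refine (congrArg (· • _) hcard.symm).trans_le ?_
  refine Finset.card_nsmul_le_sum _ _ _ fun j hj => antitone_sortedDesc e ?_
  simp only [Finset.mem_filter, Finset.mem_univ, true_and] at hj
  rw [Fin.le_def]
  simp only
  omega

/-- Exchange argument: the weight outside the top `k` positions fits into the slack `1 - r` inside
them, and the k-th largest entry separates the entries on the two sides. -/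
lemma sum_mul_le_topSum (hk : 1 ≤ k) (hkN : k ≤ N) (e r : Fin N → ℝ≥0∞)
    (hr : ∀ i, r i ≤ 1) (hsum : ∑ i, r i ≤ k) : ∑ i, r i * e i ≤ topSum k e := by
  set σ := Tuple.sort (fun i => OrderDual.toDual (e i)) with hσ
  set A := Finset.univ.filter (fun j : Fin N => (j : ℕ) < k) with hA
  have hlt : k - 1 < N := by omega
  have hcard : A.card = k := by
    rw [hA, Fin.card_filter_val_lt, min_eq_right hkN]
  have hkth : kthLargest k e = sortedDesc e ⟨k - 1, hlt⟩ := by rw [kthLargest, dif_pos hlt]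
  have h1 : ∑ i, r i * e i = ∑ j, r (σ j) * sortedDesc e j :=
    (Equiv.sum_comp σ fun i => r i * e i).symm
  have h2 : ∑ j, r (σ j) ≤ k := by
    rw [Equiv.sum_comp σ r]
    exact hsum
  rw [← Finset.sum_add_sum_compl A] at h2
  have h3 : ∑ j ∈ Aᶜ, r (σ j) ≤ ∑ j ∈ A, (1 - r (σ j)) := by
    have hfin : ∑ j ∈ A, r (σ j) ≠ ∞ := by
      refine (ENNReal.sum_lt_top.2 fun j _ => (hr _).trans_lt ENNReal.one_lt_top).ne
    refine (ENNReal.add_le_add_iff_left hfin).1 (h2.trans_eq ?_)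
    rw [← Finset.sum_add_distrib]
    simp_rw [add_tsub_cancel_of_le (hr _)]
    simp [hcard]
  rw [h1, ← Finset.sum_add_sum_compl A, topSum]
  calc ∑ j ∈ A, r (σ j) * sortedDesc e j + ∑ j ∈ Aᶜ, r (σ j) * sortedDesc e j
      ≤ ∑ j ∈ A, r (σ j) * sortedDesc e j + ∑ j ∈ Aᶜ, r (σ j) * kthLargest k e := by
        gcongr with j hj
        rw [hkth]
        refine antitone_sortedDesc e ?_
        simp only [hA, Finset.mem_compl, Finset.mem_filter, Finset.mem_univ, true_and] at hj
        rw [Fin.le_def]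
        simp only
        omega
    _ ≤ ∑ j ∈ A, r (σ j) * sortedDesc e j + ∑ j ∈ A, (1 - r (σ j)) * kthLargest k e := by
        rw [← Finset.sum_mul, ← Finset.sum_mul]
        gcongr
    _ ≤ ∑ j ∈ A, r (σ j) * sortedDesc e j + ∑ j ∈ A, (1 - r (σ j)) * sortedDesc e j := by
        gcongr with j hj
        rw [hkth]
        refine antitone_sortedDesc e ?_
        simp only [hA, Finset.mem_filter, Finset.mem_univ, true_and] at hj
        rw [Fin.le_def]
        simp only
        omega
    _ = ∑ j ∈ A, sortedDesc e j := by
        rw [← Finset.sum_add_distrib]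
        refine Finset.sum_congr rfl fun j _ => ?_
        rw [← add_mul, add_tsub_cancel_of_le (hr _), one_mul]

lemma sum_selectionProb_mul_le_topSum (hk : 1 ≤ k) (hkN : k ≤ N) (e : Fin N → ℝ≥0∞) :
    ∑ i, selectionProb k e i * e i ≤ topSum k e :=
  sum_mul_le_topSum hk hkN e _ (selectionProb_le_one hk hkN e) (sum_selectionProb hk hkN e).le

/-- An agent with posterior mean `x` is selected if fewer than `k` agents have a posterior mean of
at least `t ≤ x`. -/
lemma one_le_selectionProb_update (hk : 1 ≤ k) (hkN : k ≤ N) (e : Fin N → ℝ≥0∞) (i : Fin N)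
    {t x : ℝ≥0∞} (ht : kthLargest k e < t) (hx : t ≤ x) :
    1 ≤ selectionProb k (Function.update e i x) i := by
  set e' := Function.update e i x with he'
  have hcount : (Finset.univ.filter fun j => t ≤ e j).card < k := by
    by_contra h
    exact absurd ((le_kthLargest_iff hk hkN e t).2 (not_lt.mp h)) (not_le.mpr ht)
  have hxk : kthLargest k e' ≤ x := by
    by_contra h
    have h1 := (lt_kthLargest_iff hk hkN e' x).1 (not_le.mp h)
    refine absurd (h1.trans (Finset.card_le_card ?_)) (not_le.mpr hcount)
    intro j hj
    simp only [Finset.mem_filter, Finset.mem_univ, true_and] at hj ⊢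
    rcases eq_or_ne j i with rfl | hji
    · simp [he'] at hj
    · rw [he', Function.update_of_ne hji] at hj
      exact hx.trans hj.le
  have hei : e' i = x := by simp [he']
  unfold selectionProb
  by_cases h1 : i ∈ winners k e'
  · simp [h1]
  have h2 : kthLargest k e' = x := by
    simp only [winners, Finset.mem_filter, Finset.mem_univ, true_and, hei, not_lt] at h1
    exact le_antisymm hxk h1
  have h3 : i ∈ tied k e' := by simp [tied, hei, h2]
  rw [if_neg h1, if_pos h3]
  -- Apart from `i`, every agent at or above `x` already had a mean of at least `t`, and there are
  -- at most `k - 1` of those. So the tied agents all find a place.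
  have hle : (winners k e').card + (tied k e').card ≤ k := by
    rw [card_winners_add_card_tied, h2]
    have hsub : (Finset.univ.filter fun j => x ≤ e' j) ⊆
        insert i (Finset.univ.filter fun j => t ≤ e j) := by
      intro j hj
      simp only [Finset.mem_filter, Finset.mem_univ, true_and, Finset.mem_insert] at hj ⊢
      rcases eq_or_ne j i with rfl | hji
      · exact Or.inl rfl
      · rw [he', Function.update_of_ne hji] at hj
        exact Or.inr (hx.trans hj)
    have := (Finset.card_le_card hsub).trans (Finset.card_insert_le _ _)
    omega
  have hT : ((tied k e').card : ℝ≥0∞) ≠ 0 := by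
    exact_mod_cast (card_tied_pos hk hkN e').ne'
  rw [ENNReal.le_div_iff_mul_le (Or.inl hT) (Or.inl (ENNReal.natCast_ne_top _)), one_mul]
  refine ENNReal.le_sub_of_add_le_left (ENNReal.natCast_ne_top _) ?_
  exact_mod_cast hle

lemma measurable_card_filter {α ι : Type*} [MeasurableSpace α] [Fintype ι] (p : ι → α → Prop)
    [∀ a, DecidablePred fun j => p j a] (hp : ∀ j, MeasurableSet {a | p j a}) :
    Measurable fun a => (Finset.univ.filter fun j => p j a).card := by
  classical
  simp_rw [Finset.card_filter]
  refine Finset.measurable_sum _ fun j _ => ?_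
  convert Measurable.ite (hp j) (measurable_const (a := 1)) (measurable_const (a := 0))

lemma measurable_kthLargest (hk : 1 ≤ k) (hkN : k ≤ N) :
    Measurable (kthLargest k : (Fin N → ℝ≥0∞) → ℝ≥0∞) := by
  refine measurable_of_Ioi fun c => ?_
  have : kthLargest k ⁻¹' Set.Ioi c =
      {e : Fin N → ℝ≥0∞ | k ≤ (Finset.univ.filter fun j => c < e j).card} := by
    ext e
    exact lt_kthLargest_iff hk hkN e c
  rw [this]
  refine measurableSet_le measurable_const ?_
  exact measurable_card_filter (fun j (e : Fin N → ℝ≥0∞) => c < e j) fun j =>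
    measurableSet_lt measurable_const (measurable_pi_apply j)

lemma measurable_selectionProb (hk : 1 ≤ k) (hkN : k ≤ N) (i : Fin N) :
    Measurable fun e : Fin N → ℝ≥0∞ => selectionProb k e i := by
  have hkth := measurable_kthLargest hk hkN
  have hw : ∀ j, MeasurableSet {e : Fin N → ℝ≥0∞ | kthLargest k e < e j} := fun j =>
    measurableSet_lt hkth (measurable_pi_apply j)
  have ht : ∀ j, MeasurableSet {e : Fin N → ℝ≥0∞ | e j = kthLargest k e} := fun j =>
    measurableSet_eq_fun (measurable_pi_apply j) hkth
  have hcw : Measurable fun e : Fin N → ℝ≥0∞ => ((winners k e).card : ℝ≥0∞) :=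
    measurable_from_nat.comp (measurable_card_filter (fun j (e : Fin N → ℝ≥0∞) => _) hw)
  have hct : Measurable fun e : Fin N → ℝ≥0∞ => ((tied k e).card : ℝ≥0∞) :=
    measurable_from_nat.comp (measurable_card_filter (fun j (e : Fin N → ℝ≥0∞) => _) ht)
  unfold selectionProb
  refine Measurable.ite ?_ measurable_const
    (Measurable.ite ?_ ((measurable_const.sub hcw).div hct) measurable_const)
  · simpa [winners] using hw i
  · simpa [tied] using ht i

end Selection

end CompetitivePersuasion

/-! ### Posterior expectations and signaling schemes refined by a coin -/

namespace CompetitivePersuasion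

noncomputable section

/-- The kernel that flips a coin of bias `p a`. -/
def coin {α : Type*} [MeasurableSpace α] (p : α → ℝ≥0∞) (hp : Measurable p) : Kernel α Bool where
  toFun a := p a • Measure.dirac true + (1 - p a) • Measure.dirac false
  measurable' := by
    refine Measure.measurable_of_measurable_coe _ fun s _ => ?_
    simp only [Measure.add_apply, Measure.smul_apply, smul_eq_mul]
    exact (hp.mul_const _).add ((measurable_const.sub hp).mul_const _)

lemma coin_apply {α : Type*} [MeasurableSpace α] (p : α → ℝ≥0∞) (hp : Measurable p) (a : α) :
    coin p hp a = p a • Measure.dirac true + (1 - p a) • Measure.dirac false := rfl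

lemma lintegral_coin {α : Type*} [MeasurableSpace α] (p : α → ℝ≥0∞) (hp : Measurable p) (a : α)
    (f : Bool → ℝ≥0∞) : ∫⁻ b, f b ∂(coin p hp a) = p a * f true + (1 - p a) * f false := by
  rw [coin_apply, lintegral_add_measure, lintegral_smul_measure, lintegral_smul_measure,
    lintegral_dirac, lintegral_dirac, smul_eq_mul, smul_eq_mul]

lemma isMarkovKernel_coin {α : Type*} [MeasurableSpace α] (p : α → ℝ≥0∞) (hp : Measurable p)
    (hp1 : ∀ a, p a ≤ 1) : IsMarkovKernel (coin p hp) := by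
  refine ⟨fun a => ⟨?_⟩⟩
  rw [coin_apply]
  simp [add_tsub_cancel_of_le (hp1 a)]

lemma measurable_value : Measurable value := by
  unfold value
  fun_prop

lemma value_le_one (v : unitInterval) : value v ≤ 1 := by
  unfold value
  exact ENNReal.ofReal_le_one.2 v.2.2

namespace SignalingScheme

instance (Z : SignalingScheme.{u}) (F : ProbabilityMeasure unitInterval) :
    IsProbabilityMeasure (Z.signalLaw F) := by
  unfold signalLaw
  infer_instance

variable (Z : SignalingScheme.{u}) (F : ProbabilityMeasure unitInterval)

lemma measurable_posteriorExpectation {f : unitInterval → ℝ≥0∞} (hf : Measurable f) :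
    Measurable (Z.posteriorExpectation F f) :=
  hf.lintegral_kernel

lemma measurable_posteriorMean : Measurable (Z.posteriorMean F) :=
  Z.measurable_posteriorExpectation F measurable_value

lemma posteriorMean_le_one (s : Z.Signal) : Z.posteriorMean F s ≤ 1 := by
  refine (lintegral_mono value_le_one).trans ?_
  simp

/-- Bayes' rule: both sides disintegrate the joint law of value and signal. -/
lemma lintegral_signalLaw_posterior {f : unitInterval → Z.Signal → ℝ≥0∞}
    (hf : Measurable (Function.uncurry f)) :
    ∫⁻ s, ∫⁻ v, f v s ∂(posterior Z.kernel (F : Measure unitInterval) s) ∂(Z.signalLaw F) =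
      ∫⁻ v, ∫⁻ s, f v s ∂(Z.kernel v) ∂(F : Measure unitInterval) := by
  have h := compProd_posterior_eq_map_swap (κ := Z.kernel) (μ := (F : Measure unitInterval))
  have h1 := Measure.lintegral_compProd (μ := Z.signalLaw F)
    (κ := posterior Z.kernel (F : Measure unitInterval)) (f := fun p => f p.2 p.1)
    (hf.comp measurable_swap)
  have h2 := Measure.lintegral_compProd (μ := (F : Measure unitInterval)) (κ := Z.kernel)
    (f := fun p => f p.1 p.2) hf
  have h3 := lintegral_map (μ := (F : Measure unitInterval) ⊗ₘ Z.kernel)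
    (f := fun p : Z.Signal × unitInterval => f p.2 p.1) (hf.comp measurable_swap) measurable_swap
  rw [← h1, ← h2, signalLaw, h, h3]
  rfl

lemma lintegral_posteriorExpectation {f : unitInterval → ℝ≥0∞} (hf : Measurable f) :
    ∫⁻ s, Z.posteriorExpectation F f s ∂(Z.signalLaw F) = ∫⁻ v, f v ∂(F : Measure unitInterval) := by
  unfold posteriorExpectation
  rw [lintegral_signalLaw_posterior Z F (f := fun v _ => f v) (hf.comp measurable_fst)]
  simp

/-- The scheme that reveals, next to the signal of `Z`, a coin whose bias depends on the value and
the signal. -/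
def withCoin (p : unitInterval × Z.Signal → ℝ≥0∞) (hp : Measurable p) (hp1 : ∀ x, p x ≤ 1) :
    SignalingScheme.{u} where
  Signal := Z.Signal × Bool
  measurableSpace := inferInstance
  kernel := Z.kernel ⊗ₖ coin p hp
  isMarkov := by
    have := isMarkovKernel_coin p hp hp1
    infer_instance

/-- `Z'` sends the signal `σ` of `Z` together with a coin `β` of bias `p`, so that `ι s b` is its
signal when `Z` sends `s` and the coin shows `b`. -/
structure IsCoinExtension (Z : SignalingScheme.{u}) (F : ProbabilityMeasure unitInterval)
    (p : unitInterval × Z.Signal → ℝ≥0∞) (Z' : SignalingScheme.{u}) (σ : Z'.Signal → Z.Signal)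
    (β : Z'.Signal → Bool) (ι : Z.Signal → Bool → Z'.Signal) : Prop where
  measurable_signal : Measurable σ
  measurable_coin : Measurable β
  signal_apply : ∀ s b, σ (ι s b) = s
  coin_apply : ∀ s b, β (ι s b) = b
  lintegral_mul : ∀ {φ : Z'.Signal → ℝ≥0∞} {f : unitInterval → ℝ≥0∞}, Measurable φ → Measurable f →
    ∫⁻ x, φ x * Z'.posteriorExpectation F f x ∂(Z'.signalLaw F) =
      ∫⁻ s, ∫⁻ v, (p (v, s) * (φ (ι s true) * f v) + (1 - p (v, s)) * (φ (ι s false) * f v))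
        ∂(posterior Z.kernel (F : Measure unitInterval) s) ∂(Z.signalLaw F)

/-- Both sides of the integral identity become, by Bayes' rule, integrals over the value, then the
signal, then the coin. The analysis of the deviation rests on this interface alone. -/
lemma isCoinExtension_withCoin (p : unitInterval × Z.Signal → ℝ≥0∞) (hp : Measurable p)
    (hp1 : ∀ x, p x ≤ 1) :
    IsCoinExtension Z F p (Z.withCoin p hp hp1) Prod.fst Prod.snd Prod.mk where
  measurable_signal := measurable_fst
  measurable_coin := measurable_snd
  signal_apply _ _ := rfl
  coin_apply _ _ := rfl
  lintegral_mul {φ f} hφ hf := by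
    have := isMarkovKernel_coin p hp hp1
    have hφ' : Measurable (α := Z.Signal × Bool) φ := hφ
    have hφb : ∀ b, Measurable fun q : unitInterval × Z.Signal => φ (q.2, b) * f q.1 := fun b =>
      (hφ'.comp (measurable_snd.prodMk measurable_const)).mul (hf.comp measurable_fst)
    have h1 : ∀ x, φ x * (Z.withCoin p hp hp1).posteriorExpectation F f x =
        ∫⁻ v, φ x * f v
          ∂(posterior (Z.withCoin p hp hp1).kernel (F : Measure unitInterval) x) := fun x =>
      (lintegral_const_mul _ hf).symm
    rw [lintegral_congr h1, lintegral_signalLaw_posterior (Z.withCoin p hp hp1) F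
      (f := fun v x => φ x * f v) ((hφ.comp measurable_snd).mul (hf.comp measurable_fst)),
      lintegral_signalLaw_posterior Z F
        (f := fun v s => p (v, s) * (φ (s, true) * f v) + (1 - p (v, s)) * (φ (s, false) * f v))
        ((hp.mul (hφb true)).add ((measurable_const.sub hp).mul (hφb false)))]
    refine lintegral_congr fun v => ?_
    refine (Kernel.lintegral_compProd Z.kernel (coin p hp) v (f := fun x => φ x * f v)
      (hφ'.mul_const _)).trans ?_
    refine lintegral_congr fun s => ?_
    rw [lintegral_coin]

/-- The bias of the coin that pools, at the signals in `B`, all values above `t` with a fraction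
`a` of the lower ones. -/
def poolingBias {S : Type*} (t : ℝ≥0∞) (a : S → ℝ≥0∞) (B : Set S) (x : unitInterval × S) : ℝ≥0∞ :=
  open Classical in if x.2 ∈ B then (if t ≤ value x.1 then 1 else a x.2) else 0

variable {Z F}

/-! ### The pooling coin and its effect on the mean -/

section Pooling

variable {S : Type*} {t : ℝ≥0∞} {a : S → ℝ≥0∞} {B : Set S}

lemma measurable_poolingBias [MeasurableSpace S] (ha : Measurable a) (hB : MeasurableSet B) :
    Measurable (poolingBias t a B) := by
  classical
  unfold poolingBias
  refine Measurable.ite (measurable_snd hB) (Measurable.ite ?_ measurable_const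
    (ha.comp measurable_snd)) measurable_const
  exact measurableSet_le measurable_const (measurable_value.comp measurable_fst)

lemma poolingBias_le_one (ha1 : ∀ s, a s ≤ 1) (x : unitInterval × S) :
    poolingBias t a B x ≤ 1 := by
  unfold poolingBias
  split_ifs
  · exact le_rfl
  · exact ha1 _
  · exact zero_le

lemma poolingBias_of_notMem {s : S} (hs : s ∉ B) (v : unitInterval) :
    poolingBias t a B (v, s) = 0 := by
  simp [poolingBias, hs]

lemma le_poolingBias {s : S} (hs : s ∈ B) (ha1 : a s ≤ 1) (v : unitInterval) :
    a s ≤ poolingBias t a B (v, s) := by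
  simp only [poolingBias, hs, if_true]
  split_ifs
  · exact ha1
  · exact le_rfl

/-- Raising the admitted low values to `t` costs at most `a s * t`, which the excess of the high
values covers. -/
lemma lintegral_poolingBias_le (μ : Measure unitInterval) [IsProbabilityMeasure μ]
    {s : S} (ha : a s * t ≤ ∫⁻ v, (value v - t) ∂μ) :
    ∫⁻ v, poolingBias t a B (v, s) * t ∂μ ≤ ∫⁻ v, poolingBias t a B (v, s) * value v ∂μ := by
  by_cases hs : s ∈ B
  swap
  · simp [poolingBias_of_notMem hs]
  have hm := measurable_value
  set g := ∫⁻ v, (value v - t) ∂μ with hg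
  have hg_top : g ≠ ∞ := by
    refine ((lintegral_mono fun v => tsub_le_self.trans (value_le_one v)).trans_lt ?_).ne
    simp
  -- Stated additively because subtraction truncates; the finite excess `g` is cancelled after
  -- integration.
  have hpt : ∀ v, poolingBias t a B (v, s) * t + (value v - t) ≤
      poolingBias t a B (v, s) * value v + a s * t := by
    intro v
    simp only [poolingBias, hs, if_true]
    split_ifs with h
    · rw [one_mul, one_mul, add_tsub_cancel_of_le h]
      exact le_self_add
    · rw [tsub_eq_zero_of_le (not_le.mp h).le, add_zero]
      exact le_add_self
  have hint := lintegral_mono (μ := μ) hpt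
  rw [lintegral_add_right (g := fun v => value v - t) _ (hm.sub measurable_const),
    lintegral_add_right _ measurable_const,
    lintegral_const, measure_univ, mul_one, ← hg] at hint
  exact (ENNReal.add_le_add_iff_right hg_top).1 (hint.trans (add_le_add_right ha _))

end Pooling

/-! ### The pooling deviation and best responses -/

section Deviation

variable {t : ℝ≥0∞} {a : Z.Signal → ℝ≥0∞} {B : Set Z.Signal} {Z' : SignalingScheme.{u}}
  {σ : Z'.Signal → Z.Signal} {β : Z'.Signal → Bool} {ι : Z.Signal → Bool → Z'.Signal}

lemma posteriorExpectation_one (Z : SignalingScheme.{u}) (F : ProbabilityMeasure unitInterval)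
    (s : Z.Signal) : Z.posteriorExpectation F (fun _ => 1) s = 1 := by
  simp [posteriorExpectation]

/-- Posterior means are only determined almost surely, so integrals over arbitrary sets of signals
are compared. They reduce to `lintegral_poolingBias_le` at each signal of `Z`. -/
lemma IsCoinExtension.ae_le_posteriorMean (h : IsCoinExtension Z F (poolingBias t a B) Z' σ β ι)
    (ham : Measurable a) (hB : MeasurableSet B)
    (ha : ∀ s, a s * t ≤ Z.posteriorExpectation F (fun v => value v - t) s) :
    ∀ᵐ x ∂(Z'.signalLaw F), β x = true → t ≤ Z'.posteriorMean F x := by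
  have hT : MeasurableSet {x | β x = true} := h.measurable_coin (MeasurableSet.singleton true)
  have hTm : Measurable fun x => if β x = true then t else 0 :=
    Measurable.ite hT measurable_const measurable_const
  have key : (fun x => if β x = true then t else 0) ≤ᵐ[Z'.signalLaw F]
      Z'.posteriorMean F := by
    refine ae_le_of_forall_setLIntegral_le_of_sigmaFinite hTm fun A hA _ => ?_
    have hA1 : Measurable (A.indicator (1 : Z'.Signal → ℝ≥0∞)) := measurable_one.indicator hA
    -- The factor `𝔼[1 ∣ x] = 1` is inserted to bring the integral into the form required by
    -- `lintegral_mul`.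
    have h1 : ∫⁻ x in A, (if β x = true then t else 0) ∂(Z'.signalLaw F) =
        ∫⁻ x, A.indicator 1 x * (if β x = true then t else 0) *
          Z'.posteriorExpectation F (fun _ => 1) x ∂(Z'.signalLaw F) := by
      rw [← lintegral_indicator hA]
      refine lintegral_congr fun x => ?_
      rw [posteriorExpectation_one]
      by_cases hx : x ∈ A <;> simp [hx]
    have h2 : ∫⁻ x in A, Z'.posteriorMean F x ∂(Z'.signalLaw F) =
        ∫⁻ x, A.indicator 1 x * Z'.posteriorExpectation F value x ∂(Z'.signalLaw F) := by
      rw [← lintegral_indicator hA]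
      refine lintegral_congr fun x => ?_
      by_cases hx : x ∈ A <;> simp [hx, posteriorMean]
    rw [h1, h2, h.lintegral_mul (φ := fun x => A.indicator 1 x * (if β x = true then t else 0))
      (hA1.mul hTm) measurable_const,
      h.lintegral_mul hA1 measurable_value]
    refine lintegral_mono fun s => ?_
    simp only [h.coin_apply, if_true, Bool.false_eq_true, if_false, mul_zero, add_zero,
      mul_one]
    refine le_trans ?_ (lintegral_mono fun v => le_self_add)
    have hb : ∀ c : unitInterval → ℝ≥0∞, ∀ v, poolingBias t a B (v, s) *
        (A.indicator 1 (ι s true) * c v) =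
        A.indicator 1 (ι s true) * (poolingBias t a B (v, s) * c v) := fun c v => by ring
    have hpm : Measurable fun v => poolingBias t a B (v, s) :=
      (measurable_poolingBias ham hB).comp (measurable_id.prodMk measurable_const)
    rw [lintegral_congr (hb fun _ => t), lintegral_congr (hb value),
      lintegral_const_mul _ (hpm.mul_const t),
      lintegral_const_mul (f := fun v => poolingBias t a B (v, s) * value v) _
        (hpm.mul measurable_value)]
    exact mul_le_mul' le_rfl (lintegral_poolingBias_le _ (ha s))
  filter_upwards [key] with x hx hxT
  rwa [if_pos hxT] at hx

/-- Outside `B` the bias is 0 for every value, so the coin carries no information there. -/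
lemma IsCoinExtension.ae_posteriorMean_eq (h : IsCoinExtension Z F (poolingBias t a B) Z' σ β ι)
    (hB : MeasurableSet B) :
    ∀ᵐ x ∂(Z'.signalLaw F), β x = false → σ x ∉ B →
      Z'.posteriorMean F x = Z.posteriorMean F (σ x) := by
  set C : Set Z'.Signal := {x | β x = false ∧ σ x ∉ B} with hC
  have hCm : MeasurableSet C :=
    (h.measurable_coin (MeasurableSet.singleton false)).inter (h.measurable_signal hB.compl)
  have hm := (Z.measurable_posteriorMean F).comp h.measurable_signal
  have hm' := Z'.measurable_posteriorMean F
  have key : (C.indicator (Z'.posteriorMean F)) =ᵐ[Z'.signalLaw F]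
      (C.indicator fun x => Z.posteriorMean F (σ x)) := by
    refine ae_eq_of_forall_setLIntegral_eq_of_sigmaFinite (hm'.indicator hCm)
      (hm.indicator hCm) fun A hA _ => ?_
    have hA1 : Measurable ((A ∩ C).indicator (1 : Z'.Signal → ℝ≥0∞)) :=
      measurable_one.indicator (hA.inter hCm)
    have h1 : ∫⁻ x in A, C.indicator (fun x => Z.posteriorMean F (σ x)) x ∂(Z'.signalLaw F) =
        ∫⁻ x, (A ∩ C).indicator 1 x * Z.posteriorMean F (σ x) *
          Z'.posteriorExpectation F (fun _ => 1) x ∂(Z'.signalLaw F) := by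
      rw [← lintegral_indicator hA]
      refine lintegral_congr fun x => ?_
      rw [posteriorExpectation_one]
      by_cases hx : x ∈ A <;> by_cases hx' : x ∈ C <;> simp [hx, hx']
    have h2 : ∫⁻ x in A, C.indicator (Z'.posteriorMean F) x ∂(Z'.signalLaw F) =
        ∫⁻ x, (A ∩ C).indicator 1 x * Z'.posteriorExpectation F value x ∂(Z'.signalLaw F) := by
      rw [← lintegral_indicator hA]
      refine lintegral_congr fun x => ?_
      by_cases hx : x ∈ A <;> by_cases hx' : x ∈ C <;> simp [hx, hx', posteriorMean]
    rw [h1, h2, h.lintegral_mul (φ := fun x => (A ∩ C).indicator 1 x * Z.posteriorMean F (σ x))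
      (hA1.mul hm) measurable_const, h.lintegral_mul hA1 measurable_value]
    refine lintegral_congr fun s => ?_
    have hs : ι s true ∉ A ∩ C := fun hs => by simp [hC, h.coin_apply] at hs
    rw [Set.indicator_of_notMem hs]
    simp only [zero_mul, mul_zero, zero_add, h.signal_apply, mul_one]
    by_cases hsB : s ∈ B
    · have hs' : ι s false ∉ A ∩ C := fun hs' => by simp [hC, h.signal_apply, hsB] at hs'
      rw [Set.indicator_of_notMem hs']
      simp
    · simp only [poolingBias_of_notMem hsB, tsub_zero, one_mul]
      rw [lintegral_const_mul _ measurable_value, lintegral_const, measure_univ, mul_one]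
      rfl
  filter_upwards [key] with x hx hx1 hx2
  have hxC : x ∈ C := ⟨hx1, hx2⟩
  rwa [Set.indicator_of_mem hxC, Set.indicator_of_mem hxC] at hx

open Classical in
-- The function `φ` in the proof is a pessimistic selection rule: 1/2 at pooled signals, 0 at the
-- remaining signals over `B`, unchanged elsewhere. It is almost surely below the true selection
-- probability, and it already yields the left side because each value is pooled with probability at
-- least `a s`.
lemma IsCoinExtension.lintegral_le (h : IsCoinExtension Z F (poolingBias t a B) Z' σ β ι)
    {H : ℝ≥0∞ → ℝ≥0∞} (hH : Measurable H) (hHt : ∀ x, t ≤ x → 1 / 2 ≤ H x)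
    (ham : Measurable a) (hB : MeasurableSet B) (ha1 : ∀ s, a s ≤ 1)
    (ha : ∀ s, a s * t ≤ Z.posteriorExpectation F (fun v => value v - t) s)
    {f : unitInterval → ℝ≥0∞} (hf : Measurable f) :
    ∫⁻ s, (if s ∈ B then 1 / 2 * a s else H (Z.posteriorMean F s)) *
        Z.posteriorExpectation F f s ∂(Z.signalLaw F) ≤
      ∫⁻ s, H (Z'.posteriorMean F s) * Z'.posteriorExpectation F f s ∂(Z'.signalLaw F) := by
  have hm := (Z.measurable_posteriorMean F).comp h.measurable_signal
  set φ : Z'.Signal → ℝ≥0∞ := fun x => if σ x ∈ B then (if β x = true then 1 / 2 else 0)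
    else (if β x = true then 0 else H (Z.posteriorMean F (σ x))) with hφ
  have hφm : Measurable φ := by
    have hT : MeasurableSet {x | β x = true} := h.measurable_coin (MeasurableSet.singleton true)
    exact Measurable.ite (h.measurable_signal hB)
      (Measurable.ite hT measurable_const measurable_const)
      (Measurable.ite hT measurable_const (hH.comp hm))
  calc ∫⁻ s, (if s ∈ B then 1 / 2 * a s else H (Z.posteriorMean F s)) *
        Z.posteriorExpectation F f s ∂(Z.signalLaw F)
      ≤ ∫⁻ x, φ x * Z'.posteriorExpectation F f x ∂(Z'.signalLaw F) := by
        rw [h.lintegral_mul hφm hf]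
        refine lintegral_mono fun s => ?_
        simp only [posteriorExpectation]
        rw [← lintegral_const_mul _ hf]
        refine lintegral_mono fun v => ?_
        by_cases hs : s ∈ B
        · simp only [hs, if_true, hφ, h.signal_apply, h.coin_apply]
          refine le_trans ?_ le_self_add
          rw [← mul_assoc, mul_comm (1 / 2)]
          gcongr
          exact le_poolingBias hs (ha1 s) v
        · simp [hs, hφ, poolingBias_of_notMem hs, h.signal_apply, h.coin_apply]
    _ ≤ ∫⁻ x, H (Z'.posteriorMean F x) * Z'.posteriorExpectation F f x ∂(Z'.signalLaw F) := by
        refine lintegral_mono_ae ?_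
        filter_upwards [h.ae_le_posteriorMean ham hB ha, h.ae_posteriorMean_eq hB]
          with x hx1 hx2
        gcongr
        simp only [hφ]
        split_ifs with hxB hxT hxT
        · exact hHt _ (hx1 hxT)
        · exact zero_le
        · exact zero_le
        · rw [hx2 (by simpa using hxT) hxB]

/-- Against a selection probability `H`, which is at least `1 / 2` for posterior means above `t`,
an agent can pool her values at the signals in `B` so that she is selected with probability at
least `a s / 2` there, while nothing changes at the other signals. -/
lemma exists_deviation {H : ℝ≥0∞ → ℝ≥0∞} (hH : Measurable H) (hHt : ∀ x, t ≤ x → 1 / 2 ≤ H x)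
    (ham : Measurable a) (hB : MeasurableSet B) (ha1 : ∀ s, a s ≤ 1)
    (ha : ∀ s, a s * t ≤ Z.posteriorExpectation F (fun v => value v - t) s)
    {f : unitInterval → ℝ≥0∞} (hf : Measurable f) :
    ∃ Z' : SignalingScheme.{u}, open Classical in
      ∫⁻ s, (if s ∈ B then 1 / 2 * a s else H (Z.posteriorMean F s)) *
        Z.posteriorExpectation F f s ∂(Z.signalLaw F) ≤
      ∫⁻ s, H (Z'.posteriorMean F s) * Z'.posteriorExpectation F f s ∂(Z'.signalLaw F) :=
  ⟨_, (isCoinExtension_withCoin Z F (poolingBias t a B) (measurable_poolingBias ham hB)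
    (poolingBias_le_one ha1)).lintegral_le hH hHt ham hB ha1 ha hf⟩

end Deviation

/-- At a best response against the selection probability `H`, the expected excess of the value
over `t` is controlled by the selection probability. -/
lemma ae_excess_le_of_isBestResponse {H : ℝ≥0∞ → ℝ≥0∞} {t : ℝ≥0∞} (hH : Measurable H)
    (hH1 : ∀ x, H x ≤ 1) (hHt : ∀ x, t ≤ x → 1 / 2 ≤ H x) (ht0 : t ≠ 0) (ht : t ≠ ∞)
    {f : unitInterval → ℝ≥0∞} (hf : Measurable f) (hfpos : ∀ v, 0 < v → 0 < f v)
    {M : ℝ≥0∞} (hM : M ≠ ∞) (hfM : ∀ v, f v ≤ M)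
    (hbest : ∀ Z' : SignalingScheme.{u},
      ∫⁻ s, H (Z'.posteriorMean F s) * Z'.posteriorExpectation F f s ∂(Z'.signalLaw F) ≤
      ∫⁻ s, H (Z.posteriorMean F s) * Z.posteriorExpectation F f s ∂(Z.signalLaw F)) :
    ∀ᵐ s ∂(Z.signalLaw F), Z.posteriorExpectation F (fun v => value v - t) s ≤
      2 * t * H (Z.posteriorMean F s) +
        2 * (H (Z.posteriorMean F s) * Z.posteriorMean F s) := by
  classical
  set g := Z.posteriorExpectation F (fun v => value v - t) with hg
  have hgm : Measurable g :=
    Z.measurable_posteriorExpectation F (measurable_value.sub measurable_const)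
  have hm := Z.measurable_posteriorMean F
  have hU := Z.measurable_posteriorExpectation F hf
  -- The largest fraction of low values that the excess can pay for.
  set a : Z.Signal → ℝ≥0∞ := fun s => min 1 (g s / t) with ha
  have ham : Measurable a := measurable_const.min (hgm.div_const t)
  have ha1 : ∀ s, a s ≤ 1 := fun s => min_le_left _ _
  have hag : ∀ s, a s * t ≤ g s := fun s =>
    (mul_le_mul_left (min_le_right _ _) t).trans_eq (ENNReal.div_mul_cancel ht0 ht)
  -- The signals at which pooling would strictly raise the guaranteed selection probability.
  set B : Set Z.Signal := {s | H (Z.posteriorMean F s) < 1 / 2 * a s} with hB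
  have hBm : MeasurableSet B := measurableSet_lt (hH.comp hm) (ham.const_mul _)
  obtain ⟨Z', hZ'⟩ := exists_deviation (Z := Z) (F := F) hH hHt ham hBm ha1 hag hf
  have hUM : ∀ s, Z.posteriorExpectation F f s ≤ M := by
    intro s
    refine (lintegral_mono hfM).trans ?_
    simp
  have hfin : ∫⁻ s, H (Z.posteriorMean F s) * Z.posteriorExpectation F f s ∂(Z.signalLaw F) ≠ ∞ := by
    refine ((lintegral_mono fun s => mul_le_mul' (hH1 _) (hUM s)).trans_lt ?_).ne
    simpa using hM.lt_top
  -- The deviation improves the integrand pointwise, while optimality bounds its integral from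
  -- above; the original integral being finite, the two integrands agree almost everywhere.
  have heq : (fun s => H (Z.posteriorMean F s) * Z.posteriorExpectation F f s) =ᵐ[Z.signalLaw F]
      fun s => (if s ∈ B then 1 / 2 * a s else H (Z.posteriorMean F s)) *
        Z.posteriorExpectation F f s := by
    refine ae_eq_of_ae_le_of_lintegral_le (ae_of_all _ fun s => ?_) hfin
      ((Measurable.ite hBm (ham.const_mul _) (hH.comp hm)).mul hU).aemeasurable
      (le_of_eq_of_le (by congr! 4) (hZ'.trans (hbest Z')))
    dsimp only
    gcongr
    split_ifs with hs
    · exact le_of_lt hs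
    · exact le_rfl
  filter_upwards [heq] with s hs
  have hge : g s ≤ Z.posteriorMean F s := lintegral_mono fun v => tsub_le_self
  have hnB : s ∉ B := by
    intro hsB
    rw [if_pos hsB] at hs
    have hlt : H (Z.posteriorMean F s) < 1 / 2 * a s := hsB
    -- Zero expected utility forces the value to be 0 almost surely, so there is no excess, `a s =
    -- 0`, and the signal cannot lie in `B`.
    have hU0 : Z.posteriorExpectation F f s ≠ 0 := by
      intro h0
      have hf0 := (lintegral_eq_zero_iff hf).1 h0
      have hg0 : g s = 0 := by
        refine (lintegral_eq_zero_iff (measurable_value.sub measurable_const)).2 ?_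
        filter_upwards [hf0] with v hv
        have hv0 : v = 0 := by
          by_contra hne
          exact (hfpos v (unitInterval.pos_iff_ne_zero.2 hne)).ne' hv
        simp [hv0, value]
      have : a s = 0 := by simp [ha, hg0]
      simp [this] at hlt
    have hUt : Z.posteriorExpectation F f s ≠ ∞ := ((hUM s).trans_lt hM.lt_top).ne
    exact hlt.ne ((ENNReal.mul_left_inj hU0 hUt).1 hs)
  have hle : 1 / 2 * a s ≤ H (Z.posteriorMean F s) := not_lt.mp hnB
  have hle2 : a s ≤ 2 * H (Z.posteriorMean F s) := by
    calc a s = 2 * (1 / 2 * a s) := by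
          rw [← mul_assoc, one_div, ENNReal.mul_inv_cancel two_ne_zero ENNReal.ofNat_ne_top, one_mul]
      _ ≤ _ := by gcongr
  -- Each case accounts for one of the two summands. When `a s = 1`, the excess is bounded by the
  -- posterior mean itself.
  rcases le_total (g s / t) 1 with h | h
  · have has : a s = g s / t := min_eq_right h
    refine le_trans ?_ le_self_add
    calc g s = a s * t := by rw [has, ENNReal.div_mul_cancel ht0 ht]
      _ ≤ 2 * H (Z.posteriorMean F s) * t := by gcongr
      _ = _ := by ring
  · have has : a s = 1 := min_eq_left h
    refine le_trans ?_ le_add_self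
    calc g s ≤ a s * Z.posteriorMean F s := by rwa [has, one_mul]
      _ ≤ 2 * H (Z.posteriorMean F s) * Z.posteriorMean F s := by gcongr
      _ = _ := by ring

end SignalingScheme

end

end CompetitivePersuasion

namespace CompetitivePersuasion

noncomputable section

/-! ### Resampling and conditioning on one coordinate of a product measure -/

section ProductMeasure

lemma preimage_update_pi {ι : Type*} [DecidableEq ι] {X : ι → Type*} (i : ι) (c : X i)
    (s : ∀ j, Set (X j)) : (fun y => Function.update y i c) ⁻¹' Set.univ.pi s =
      {_y | c ∈ s i} ∩ Set.univ.pi (Function.update s i Set.univ) := by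
  ext y
  simp only [Set.mem_preimage, Set.mem_ofPred_eq, Set.mem_pi, Set.mem_univ, true_implies, Set.mem_inter_iff]
  constructor
  · intro h
    refine ⟨by simpa using h i, fun j => ?_⟩
    rcases eq_or_ne j i with rfl | hj
    · simp
    · simpa [Function.update_of_ne hj] using h j
  · rintro ⟨h1, h2⟩ j
    rcases eq_or_ne j i with rfl | hj
    · simpa using h1
    · simpa [Function.update_of_ne hj] using h2 j

variable {ι : Type*} [DecidableEq ι] {X : ι → Type*} [∀ i, MeasurableSpace (X i)]

lemma measurable_update_prod (i : ι) :
    Measurable fun p : (∀ j, X j) × X i => Function.update p.1 i p.2 := by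
  refine measurable_pi_lambda _ fun j => ?_
  rcases eq_or_ne j i with rfl | hj
  · simpa using measurable_snd
  · simp only [Function.update_of_ne hj]
    exact (measurable_pi_apply j).comp measurable_fst

variable [Fintype ι]

lemma prod_update_univ (μ : ∀ j, Measure (X j)) [∀ j, IsProbabilityMeasure (μ j)] (i : ι)
    (s : ∀ j, Set (X j)) :
    ∏ j, μ j (Function.update s i Set.univ j) = ∏ j ∈ Finset.univ.erase i, μ j (s j) := by
  rw [← Finset.mul_prod_erase _ _ (Finset.mem_univ i)]
  simp only [Function.update_self, measure_univ, one_mul]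
  refine Finset.prod_congr rfl fun j hj => ?_
  rw [Function.update_of_ne (Finset.ne_of_mem_erase hj)]

/-- Replacing a coordinate by an independent copy does not change a product measure. -/
lemma map_update_prod (μ : ∀ j, Measure (X j)) [∀ j, IsProbabilityMeasure (μ j)] (i : ι) :
    ((Measure.pi μ).prod (μ i)).map (fun p => Function.update p.1 i p.2) = Measure.pi μ := by
  refine (Measure.pi_eq fun s hs => ?_).symm
  rw [Measure.map_apply (measurable_update_prod i) (MeasurableSet.univ_pi hs)]
  have : (fun p : (∀ j, X j) × X i => Function.update p.1 i p.2) ⁻¹' Set.univ.pi s =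
      Set.univ.pi (Function.update s i Set.univ) ×ˢ s i := by
    ext p
    have := Set.ext_iff.1 (preimage_update_pi i p.2 s) p.1
    simp only [Set.mem_preimage, Set.mem_ofPred_eq, Set.mem_inter_iff] at this
    rw [Set.mem_preimage, this, Set.mem_prod, and_comm]
  rw [this, Measure.prod_prod, Measure.pi_pi, prod_update_univ, mul_comm,
    Finset.mul_prod_erase _ (fun j => μ j (s j)) (Finset.mem_univ i)]

/-- Overwriting coordinate `i` replaces its factor by a Dirac mass, which erases the only difference
between the two products. -/
lemma lintegral_update_congr {μ ν : ∀ j, Measure (X j)} [∀ j, IsProbabilityMeasure (μ j)]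
    [∀ j, IsProbabilityMeasure (ν j)] {i : ι} (h : ∀ j, j ≠ i → μ j = ν j)
    {f : (∀ j, X j) → ℝ≥0∞} (hf : Measurable f) (c : X i) :
    ∫⁻ y, f (Function.update y i c) ∂(Measure.pi μ) =
      ∫⁻ y, f (Function.update y i c) ∂(Measure.pi ν) := by
  have hu : Measurable fun y : ∀ j, X j => Function.update y i c :=
    (measurable_update_prod i).comp (measurable_id.prodMk measurable_const)
  have hmap : ∀ (ρ : ∀ j, Measure (X j)) [∀ j, IsProbabilityMeasure (ρ j)]
      (s : ∀ j, Set (X j)), (∀ j, MeasurableSet (s j)) →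
      (Measure.pi ρ).map (fun y => Function.update y i c) (Set.univ.pi s) =
        (s i).indicator 1 c * ∏ j ∈ Finset.univ.erase i, ρ j (s j) := by
    intro ρ _ s hs
    rw [Measure.map_apply hu (MeasurableSet.univ_pi hs), preimage_update_pi]
    by_cases hc : c ∈ s i
    · simp [hc, prod_update_univ]
    · simp [hc]
  have key : ∀ (ρ : ∀ j, Measure (X j)) [∀ j, IsProbabilityMeasure (ρ j)],
      (Measure.pi ρ).map (fun y => Function.update y i c) =
        Measure.pi (Function.update ρ i (Measure.dirac c)) := by
    intro ρ _
    have : ∀ j, IsProbabilityMeasure (Function.update ρ i (Measure.dirac c) j) := by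
      intro j
      rcases eq_or_ne j i with rfl | hj
      · rw [Function.update_self]
        infer_instance
      · rw [Function.update_of_ne hj]
        infer_instance
    refine (Measure.pi_eq fun s hs => ?_).symm
    rw [hmap ρ s hs, ← Finset.mul_prod_erase _ _ (Finset.mem_univ i), Function.update_self,
      Measure.dirac_apply' _ (hs i)]
    congr 1
    refine Finset.prod_congr rfl fun j hj => ?_
    rw [Function.update_of_ne (Finset.ne_of_mem_erase hj)]
  have heq : Function.update μ i (Measure.dirac c) = Function.update ν i (Measure.dirac c) := by
    ext1 j
    rcases eq_or_ne j i with rfl | hj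
    · simp
    · simp [Function.update_of_ne hj, h j hj]
  rw [← lintegral_map hf hu, ← lintegral_map hf hu, key μ, key ν, heq]

/-- Conditioning on one coordinate, when the integrand depends on the others through functions
`e j`. -/
lemma lintegral_pi_mul_eval {Y : Type*} [MeasurableSpace Y] (μ : ∀ j, Measure (X j))
    [∀ j, IsProbabilityMeasure (μ j)] {e : ∀ j, X j → Y} (he : ∀ j, Measurable (e j)) (i : ι)
    (ν : ι → Measure Y) [∀ j, IsProbabilityMeasure (ν j)] (hν : ∀ j, j ≠ i → ν j = (μ j).map (e j))
    {φ : (ι → Y) → ℝ≥0∞} (hφ : Measurable φ) {f : X i → ℝ≥0∞} (hf : Measurable f) :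
    ∫⁻ s, φ (fun j => e j (s j)) * f (s i) ∂(Measure.pi μ) =
      ∫⁻ x, (∫⁻ y, φ (Function.update y i (e i x)) ∂(Measure.pi ν)) * f x ∂(μ i) := by
  have hem : Measurable fun (s : ∀ j, X j) j => e j (s j) :=
    measurable_pi_lambda _ fun j => (he j).comp (measurable_pi_apply j)
  have hprob : ∀ j, IsProbabilityMeasure ((μ j).map (e j)) := fun j =>
    Measure.isProbabilityMeasure_map (he j).aemeasurable
  have hint : Measurable fun s : ∀ j, X j => φ (fun j => e j (s j)) * f (s i) :=
    (hφ.comp hem).mul (hf.comp (measurable_pi_apply i))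
  -- Coordinate `i` is resampled independently, so that Fubini separates it from the others.
  conv_lhs => rw [← map_update_prod μ i]
  rw [lintegral_map hint (measurable_update_prod i)]
  refine (lintegral_prod_symm' _ (hint.comp (measurable_update_prod i))).trans ?_
  refine lintegral_congr fun x => ?_
  have hu : Measurable fun y : ι → Y => Function.update y i (e i x) :=
    (measurable_update_prod (X := fun _ => Y) i).comp (measurable_id.prodMk measurable_const)
  have hpt : ∀ s : ∀ j, X j, (fun j => e j (Function.update s i x j)) =
      Function.update (fun j => e j (s j)) i (e i x) := by
    intro s
    ext1 j
    rcases eq_or_ne j i with rfl | hj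
    · simp
    · simp [Function.update_of_ne hj]
  simp only [Function.comp_apply, Function.update_self, hpt]
  rw [lintegral_mul_const (f := fun s : ∀ j, X j => φ (Function.update (fun j => e j (s j)) i (e i x)))
    _ ((hφ.comp hu).comp hem), lintegral_update_congr hν hφ,
    ← Measure.pi_map_pi fun j => (he j).aemeasurable,
    lintegral_map (f := fun y => φ (Function.update y i (e i x))) (hφ.comp hu) hem]

end ProductMeasure

/-! ### Equilibrium bounds and the price of anarchy -/

namespace GameInstance

variable {N k : ℕ} (G : GameInstance N)

instance (Z : Profile.{u} N) : IsProbabilityMeasure (G.jointLaw Z) := by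
  unfold jointLaw
  infer_instance

/-- The law of the posterior mean of agent `j`. -/
def meanLaw (Z : Profile.{u} N) (j : Fin N) : Measure ℝ≥0∞ :=
  ((Z j).signalLaw (G.prior j)).map ((Z j).posteriorMean (G.prior j))

instance (Z : Profile.{u} N) (j : Fin N) : IsProbabilityMeasure (G.meanLaw Z j) :=
  Measure.isProbabilityMeasure_map ((Z j).measurable_posteriorMean _).aemeasurable

lemma measurable_means (Z : Profile.{u} N) : Measurable (G.means Z) :=
  measurable_pi_lambda _ fun j =>
    ((Z j).measurable_posteriorMean (G.prior j)).comp (measurable_pi_apply j)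

/-- The probability that agent `i` is selected with posterior mean `x` when the others play
`Z`. -/
def interimSelection (k : ℕ) (Z : Profile.{u} N) (i : Fin N) (x : ℝ≥0∞) : ℝ≥0∞ :=
  ∫⁻ y, selectionProb k (Function.update y i x) i ∂(Measure.pi (G.meanLaw Z))

lemma measurable_interimSelection (hk : 1 ≤ k) (hkN : k ≤ N) (Z : Profile.{u} N) (i : Fin N) :
    Measurable (G.interimSelection k Z i) := by
  have h : Measurable fun p : (Fin N → ℝ≥0∞) × ℝ≥0∞ =>
      selectionProb k (Function.update p.1 i p.2) i :=
    (measurable_selectionProb hk hkN i).comp (measurable_update_prod (X := fun _ => ℝ≥0∞) i)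
  exact h.lintegral_prod_left'

lemma interimSelection_le_one (hk : 1 ≤ k) (hkN : k ≤ N) (Z : Profile.{u} N) (i : Fin N)
    (x : ℝ≥0∞) : G.interimSelection k Z i x ≤ 1 := by
  refine (lintegral_mono fun y => selectionProb_le_one hk hkN _ i).trans ?_
  simp

lemma lintegral_means (Z : Profile.{u} N) {φ : (Fin N → ℝ≥0∞) → ℝ≥0∞} (hφ : Measurable φ) :
    ∫⁻ y, φ y ∂(Measure.pi (G.meanLaw Z)) = ∫⁻ s, φ (G.means Z s) ∂(G.jointLaw Z) := by
  rw [jointLaw, ← lintegral_map hφ (G.measurable_means Z)]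
  have hp : ∀ j, IsProbabilityMeasure
    (((Z j).signalLaw (G.prior j)).map ((Z j).posteriorMean (G.prior j))) := fun j =>
    Measure.isProbabilityMeasure_map ((Z j).measurable_posteriorMean _).aemeasurable
  have := Measure.pi_map_pi (μ := fun j => (Z j).signalLaw (G.prior j))
    (f := fun j => (Z j).posteriorMean (G.prior j))
    fun j => ((Z j).measurable_posteriorMean _).aemeasurable
  change _ = lintegral (Measure.map (fun (s : ∀ j, (Z j).Signal) j =>
    (Z j).posteriorMean (G.prior j) (s j)) _) _
  rw [this]
  rfl

/-- The interim selection probability ignores the scheme of agent `i` herself, so the same function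
`interimSelection` evaluates both `Z` and every unilateral deviation `Z'`. -/
lemma lintegral_selectionProb_mul (hk : 1 ≤ k) (hkN : k ≤ N) {Z Z' : Profile.{u} N} {i : Fin N}
    (h : ∀ j, j ≠ i → Z' j = Z j) {f : (Z' i).Signal → ℝ≥0∞} (hf : Measurable f) :
    ∫⁻ s, selectionProb k (G.means Z' s) i * f (s i) ∂(G.jointLaw Z') =
      ∫⁻ x, G.interimSelection k Z i ((Z' i).posteriorMean (G.prior i) x) * f x
        ∂((Z' i).signalLaw (G.prior i)) :=
  lintegral_pi_mul_eval (fun j => (Z' j).signalLaw (G.prior j))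
    (e := fun j => (Z' j).posteriorMean (G.prior j)) (fun j => (Z' j).measurable_posteriorMean _) i
    (G.meanLaw Z) (fun j hj => by rw [meanLaw, h j hj]) (measurable_selectionProb hk hkN i) hf

lemma measurable_utility (i : Fin N) : Measurable fun v => (G.utility i v : ℝ≥0∞) :=
  (ENNReal.continuous_coe.comp (G.continuous_utility i)).measurable

lemma expectedUtility_update (hk : 1 ≤ k) (hkN : k ≤ N) (Z : Profile.{u} N) (i : Fin N)
    (Z' : SignalingScheme.{u}) :
    G.expectedUtility k (Function.update Z i Z') i =
      ∫⁻ x, G.interimSelection k Z i (Z'.posteriorMean (G.prior i) x) *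
        Z'.posteriorExpectation (G.prior i) (fun v => (G.utility i v : ℝ≥0∞)) x
        ∂(Z'.signalLaw (G.prior i)) := by
  have h := G.lintegral_selectionProb_mul hk hkN (Z := Z) (Z' := Function.update Z i Z') (i := i)
    (fun j hj => Function.update_of_ne hj _ _)
    ((Function.update Z i Z' i).measurable_posteriorExpectation (G.prior i)
      (G.measurable_utility i))
  refine h.trans ?_
  rw [Function.update_self]

lemma expectedUtility_eq (hk : 1 ≤ k) (hkN : k ≤ N) (Z : Profile.{u} N) (i : Fin N) :
    G.expectedUtility k Z i =
      ∫⁻ x, G.interimSelection k Z i ((Z i).posteriorMean (G.prior i) x) *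
        (Z i).posteriorExpectation (G.prior i) (fun v => (G.utility i v : ℝ≥0∞)) x
        ∂((Z i).signalLaw (G.prior i)) :=
  G.lintegral_selectionProb_mul hk hkN (fun _ _ => rfl)
    ((Z i).measurable_posteriorExpectation (G.prior i) (G.measurable_utility i))

/-- A posterior mean of twice the average selected one is selected with probability `1 / 2`. -/
lemma half_le_interimSelection (hk : 1 ≤ k) (hkN : k ≤ N) (Z : Profile.{u} N) (i : Fin N)
    {t x : ℝ≥0∞} (ht0 : t ≠ 0) (ht : t ≠ ∞) (hW : 2 * G.socialWelfare k Z ≤ k * t) (hx : t ≤ x) :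
    1 / 2 ≤ G.interimSelection k Z i x := by
  set P := Measure.pi (G.meanLaw Z) with hP
  have hkth : Measurable (kthLargest k : (Fin N → ℝ≥0∞) → ℝ≥0∞) := measurable_kthLargest hk hkN
  have hk0 : (k : ℝ≥0∞) ≠ 0 := by exact_mod_cast (by omega : k ≠ 0)
  -- Markov's inequality for the k-th largest mean, multiplied through by `k * t` so that nothing is
  -- divided until this factor is cancelled.
  have hmarkov : P {y | t ≤ kthLargest k y} ≤ 1 / 2 := by
    have h1 := mul_meas_ge_le_lintegral (μ := P) hkth t
    have h2 : k * ∫⁻ y, kthLargest k y ∂P ≤ G.socialWelfare k Z := by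
      rw [hP, lintegral_means G Z hkth, ← lintegral_const_mul
        (f := fun s => kthLargest k (G.means Z s)) _ (hkth.comp (G.measurable_means Z))]
      exact lintegral_mono fun s => mul_kthLargest_le_topSum hk hkN _
    have h3 : (k * t) * (2 * P {y | t ≤ kthLargest k y}) ≤ (k * t) * 1 := by
      calc (k * t) * (2 * P {y | t ≤ kthLargest k y})
          = 2 * (k * (t * P {y | t ≤ kthLargest k y})) := by ring
        _ ≤ 2 * G.socialWelfare k Z := by
          gcongr
          exact (mul_le_mul_right h1 _).trans h2
        _ ≤ (k * t) * 1 := by rwa [mul_one]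
    rw [ENNReal.mul_le_mul_iff_right (mul_ne_zero hk0 ht0)
      (ENNReal.mul_ne_top (ENNReal.natCast_ne_top k) ht)] at h3
    rw [ENNReal.le_div_iff_mul_le (Or.inl two_ne_zero) (Or.inl ENNReal.ofNat_ne_top), mul_comm]
    exact h3
  have hA : MeasurableSet {y : Fin N → ℝ≥0∞ | t ≤ kthLargest k y} :=
    measurableSet_le measurable_const hkth
  calc (1 / 2 : ℝ≥0∞) = 1 - 1 / 2 := by rw [one_div, ENNReal.one_sub_inv_two]
    _ ≤ 1 - P {y | t ≤ kthLargest k y} := tsub_le_tsub_left hmarkov _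
    _ = P {y | t ≤ kthLargest k y}ᶜ := (prob_compl_eq_one_sub hA).symm
    _ = ∫⁻ y, {y | t ≤ kthLargest k y}ᶜ.indicator 1 y ∂P := (lintegral_indicator_one hA.compl).symm
    _ ≤ G.interimSelection k Z i x := by
      refine lintegral_mono fun y => ?_
      by_cases hy : t ≤ kthLargest k y
      · simp [hy]
      · simpa [hy] using one_le_selectionProb_update hk hkN y i (not_le.mp hy) hx

/-- Each selected value is at most `t` plus its excess, and the excess of unselected agents is
nonnegative. -/
lemma sup_powersetCard_le (v : Fin N → unitInterval) (t : ℝ≥0∞) :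
    (Finset.powersetCard k Finset.univ).sup (fun S => ∑ i ∈ S, value (v i)) ≤
      k * t + ∑ i, (value (v i) - t) := by
  refine Finset.sup_le fun S hS => ?_
  calc ∑ i ∈ S, value (v i) ≤ ∑ i ∈ S, (t + (value (v i) - t)) :=
        Finset.sum_le_sum fun i _ => le_add_tsub
    _ = k * t + ∑ i ∈ S, (value (v i) - t) := by
        rw [Finset.sum_add_distrib, Finset.sum_const, (Finset.mem_powersetCard.1 hS).2,
          nsmul_eq_mul]
    _ ≤ k * t + ∑ i, (value (v i) - t) := by
        gcongr
        exact Finset.subset_univ _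

lemma firstBest_le (t : ℝ≥0∞) :
    G.firstBest k ≤ k * t + ∑ i, ∫⁻ v, (value v - t) ∂(G.prior i : Measure unitInterval) := by
  have hm : ∀ i, Measurable fun v : Fin N → unitInterval => value (v i) - t := fun i =>
    (measurable_value.comp (measurable_pi_apply i)).sub measurable_const
  refine (lintegral_mono fun v => sup_powersetCard_le v t).trans_eq ?_
  rw [lintegral_add_left measurable_const, lintegral_const, measure_univ, mul_one,
    lintegral_finsetSum _ fun i _ => hm i]
  congr 1
  refine Finset.sum_congr rfl fun i _ => ?_
  have hmp := measurePreserving_eval (fun i => (G.prior i : Measure unitInterval)) i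
  exact hmp.lintegral_comp (f := fun v => value v - t) (measurable_value.sub measurable_const)

/-- In an equilibrium, the expected excess of the value of an agent over `t` is controlled by her
probability of being selected and her contribution to the welfare. -/
lemma lintegral_excess_le (hk : 1 ≤ k) (hkN : k ≤ N) {Z : Profile.{u} N}
    (hZ : Z ∈ G.nashEquilibria k) {t : ℝ≥0∞} (ht0 : t ≠ 0) (ht : t ≠ ∞)
    (hW : 2 * G.socialWelfare k Z ≤ k * t) (i : Fin N) :
    ∫⁻ v, (value v - t) ∂(G.prior i : Measure unitInterval) ≤
      2 * t * ∫⁻ s, selectionProb k (G.means Z s) i ∂(G.jointLaw Z) +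
        2 * ∫⁻ s, selectionProb k (G.means Z s) i * G.means Z s i ∂(G.jointLaw Z) := by
  have hH := G.measurable_interimSelection hk hkN Z i
  have hm := (Z i).measurable_posteriorMean (G.prior i)
  have hsel := G.lintegral_selectionProb_mul hk hkN (Z := Z) (Z' := Z) (i := i) (fun _ _ => rfl)
    (f := fun _ => 1) measurable_const
  have hcon := G.lintegral_selectionProb_mul hk hkN (Z := Z) (Z' := Z) (i := i) (fun _ _ => rfl) hm
  simp only [mul_one] at hsel
  have hcon' : ∫⁻ s, selectionProb k (G.means Z s) i * G.means Z s i ∂(G.jointLaw Z) = _ := hcon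
  rw [← (Z i).lintegral_posteriorExpectation (G.prior i) (f := fun v => value v - t)
    (measurable_value.sub measurable_const), hsel, hcon',
    ← lintegral_const_mul
      (f := fun x => G.interimSelection k Z i ((Z i).posteriorMean (G.prior i) x)) _ (hH.comp hm),
    ← lintegral_const_mul (f := fun x => G.interimSelection k Z i
      ((Z i).posteriorMean (G.prior i) x) * (Z i).posteriorMean (G.prior i) x) _
      ((hH.comp hm).mul hm),
    ← lintegral_add_left (f := fun x => 2 * t * G.interimSelection k Z i
      ((Z i).posteriorMean (G.prior i) x)) ((hH.comp hm).const_mul (2 * t))]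
  refine lintegral_mono_ae ?_
  refine SignalingScheme.ae_excess_le_of_isBestResponse hH
    (G.interimSelection_le_one hk hkN Z i)
    (fun x hx => G.half_le_interimSelection hk hkN Z i ht0 ht hW hx) ht0 ht
    (G.measurable_utility i) (fun v hv => by exact_mod_cast G.utility_pos i v hv)
    (M := G.utility i 1) ENNReal.coe_ne_top
    (fun v => by exact_mod_cast G.monotone_utility i unitInterval.le_one') fun Z' => ?_
  rw [← G.expectedUtility_update hk hkN, ← G.expectedUtility_eq hk hkN]
  exact hZ i Z'

/-- Sum the individual excess bounds over the agents. The threshold stays free, since `2 * W / k`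
may be 0 and is then not admissible. -/
lemma firstBest_le_of_two_mul_socialWelfare_le (hk : 1 ≤ k) (hkN : k ≤ N) {Z : Profile.{u} N}
    (hZ : Z ∈ G.nashEquilibria k) {t : ℝ≥0∞} (ht0 : t ≠ 0) (ht : t ≠ ∞)
    (hW : 2 * G.socialWelfare k Z ≤ k * t) :
    G.firstBest k ≤ 3 * (k * t) + 2 * G.socialWelfare k Z := by
  have hmeans := G.measurable_means Z
  have hρ : ∀ i, Measurable fun s => selectionProb k (G.means Z s) i := fun i =>
    (measurable_selectionProb hk hkN i).comp hmeans
  have h1 : ∑ i, ∫⁻ s, selectionProb k (G.means Z s) i ∂(G.jointLaw Z) = k := by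
    rw [← lintegral_finsetSum _ fun i _ => hρ i]
    simp_rw [sum_selectionProb hk hkN]
    simp
  have h2 : ∑ i, ∫⁻ s, selectionProb k (G.means Z s) i * G.means Z s i ∂(G.jointLaw Z) ≤
      G.socialWelfare k Z := by
    rw [← lintegral_finsetSum (f := fun i s => selectionProb k (G.means Z s) i * G.means Z s i) _
      fun i _ => (hρ i).mul ((measurable_pi_apply i).comp hmeans)]
    exact lintegral_mono fun s => sum_selectionProb_mul_le_topSum hk hkN _
  calc G.firstBest k
      ≤ k * t + ∑ i, ∫⁻ v, (value v - t) ∂(G.prior i : Measure unitInterval) := G.firstBest_le t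
    _ ≤ k * t + ∑ i, (2 * t * ∫⁻ s, selectionProb k (G.means Z s) i ∂(G.jointLaw Z) +
        2 * ∫⁻ s, selectionProb k (G.means Z s) i * G.means Z s i ∂(G.jointLaw Z)) := by
        gcongr with i
        exact G.lintegral_excess_le hk hkN hZ ht0 ht hW i
    _ = k * t + (2 * t * k + 2 *
        ∑ i, ∫⁻ s, selectionProb k (G.means Z s) i * G.means Z s i ∂(G.jointLaw Z)) := by
        rw [Finset.sum_add_distrib, ← Finset.mul_sum, ← Finset.mul_sum, h1]
    _ ≤ k * t + (2 * t * k + 2 * G.socialWelfare k Z) := by gcongr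
    _ = 3 * (k * t) + 2 * G.socialWelfare k Z := by ring

lemma socialWelfare_ne_top (Z : Profile.{u} N) : G.socialWelfare k Z ≠ ∞ := by
  have h : ∀ s, topSum k (G.means Z s) ≤ N := by
    intro s
    calc topSum k (G.means Z s)
        ≤ ∑ j, sortedDesc (G.means Z s) j := Finset.sum_le_univ_sum_of_nonneg fun _ => zero_le
      _ ≤ ∑ _j : Fin N, 1 := Finset.sum_le_sum fun j _ => (Z _).posteriorMean_le_one _ _
      _ = N := by simp
  refine ((lintegral_mono h).trans_lt ?_).ne
  simp

/-- The welfare of an equilibrium is at least an eighth of the first best. -/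
theorem firstBest_le_eight_mul_socialWelfare (hk : 1 ≤ k) (hkN : k ≤ N) {Z : Profile.{u} N}
    (hZ : Z ∈ G.nashEquilibria k) : G.firstBest k ≤ 8 * G.socialWelfare k Z := by
  have hk0 : (k : ℝ≥0∞) ≠ 0 := by exact_mod_cast (by omega : k ≠ 0)
  have hkt := ENNReal.natCast_ne_top k
  set W := G.socialWelfare k Z with hW
  have hWt : W ≠ ∞ := G.socialWelfare_ne_top Z
  -- Here `r` stands for `k * t`.
  have key : ∀ r : ℝ≥0∞, r ≠ 0 → r ≠ ∞ → 2 * W ≤ r → G.firstBest k ≤ 3 * r + 2 * W := by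
    intro r hr0 hrt hr
    have hmul : k * (r / k) = r := ENNReal.mul_div_cancel hk0 hkt
    have := G.firstBest_le_of_two_mul_socialWelfare_le hk hkN hZ (t := r / k)
      (ENNReal.div_ne_zero.2 ⟨hr0, hkt⟩) (ENNReal.div_ne_top hrt hk0) (by rwa [hmul])
    rwa [hmul] at this
  -- With zero welfare every positive `r` is allowed, and `3 * r` can be made arbitrarily small.
  by_cases hW0 : W = 0
  · rw [hW0, mul_zero]
    refine ENNReal.le_of_forall_pos_le_add fun ε hε _ => ?_
    have h3 : (3 : ℝ≥0∞) ≠ 0 := by norm_num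
    have h := key (ε / 3) (ENNReal.div_ne_zero.2 ⟨by exact_mod_cast hε.ne', by norm_num⟩)
      (ENNReal.div_ne_top ENNReal.coe_ne_top h3) (by simp [hW0])
    rwa [ENNReal.mul_div_cancel h3 (by norm_num), hW0, mul_zero, add_comm] at h
  -- The smallest admissible `r`, giving `3 * (2 * W) + 2 * W = 8 * W`.
  · have h := key (2 * W) (mul_ne_zero two_ne_zero hW0)
      (ENNReal.mul_ne_top ENNReal.ofNat_ne_top hWt) le_rfl
    refine h.trans_eq ?_
    ring

end GameInstance

end

end CompetitivePersuasion

theorem mainTheorem1 {N : ℕ} (k : ℕ) (hk : 1 ≤ k) (hkN : k ≤ N)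
    (G : CompetitivePersuasion.GameInstance N)
    (hNE : (CompetitivePersuasion.GameInstance.nashEquilibria.{u} G k).Nonempty) :
    CompetitivePersuasion.GameInstance.priceOfAnarchy.{u} G k ≤
      ENNReal.ofReal (11 + 5 * Real.sqrt 5) := by
  have h8 : (8 : ℝ≥0∞) ≤ ENNReal.ofReal (11 + 5 * Real.sqrt 5) := by
    rw [← ENNReal.ofReal_ofNat 8]
    refine ENNReal.ofReal_le_ofReal ?_
    have := Real.sqrt_nonneg 5
    linarith
  refine le_trans (ENNReal.div_le_of_le_mul ?_) h8
  have h80 : (8 : ℝ≥0∞) ≠ 0 := by norm_num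
  -- Moving 8 to the other side isolates the infimum, so that the bound can be checked at each
  -- equilibrium.
  rw [mul_comm, ← ENNReal.div_le_iff_le_mul (Or.inl h80) (Or.inl (by norm_num))]
  refine le_iInf₂ fun Z hZ => ?_
  rw [ENNReal.div_le_iff_le_mul (Or.inl h80) (Or.inl (by norm_num)), mul_comm]
  exact G.firstBest_le_eight_mul_socialWelfare hk hkN hZ
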